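/- For an integer $m\ge 1$, for $0<|z|<1$ and $c\in\mathbb{C}\setminus\mathbb{Z}_{\le 0}$ let $$Li_m(z,c)=\sum_{k=0}^{\infty}\frac{z^{k+1}}{(k+c)^m}.$$ Let $p:X\to \mathbb{P}^1(\mathbb{C})\setminus\{0,1,\infty\}=\mathbb{C}\setminus\{0,1\}$ be the universal cover, and let $\Omega\subset X$ be any connected component of the preimage of the punctured unit disc $\{0<|z|<1\}$ (the sheet on which the continuation starts). Then for every $m\ge 1$ there is a meromorphic function $F$ of two variables on $X\times\mathbb{C}$ that continues $Li_m$, i.e. $F(\tilde z,c)=Li_m(p(\tilde z),c)$ for all $\tilde z\in\Omega$ and $c\in\mathbb{C}\setminus\mathbb{Z}_{\le 0}$, and that is holomorphic on $X\times(\mathbb{C}\setminus\mathbb{Z}_{\le 0})$. Moreover, for every fixed $\tilde z\in X$, the function $c\mapsto F(\tilde z,c)$ is meromorphic on $\mathbb{C}$, has a pole of exact order $m$ at each point $c\in\mathbb{Z}_{\le 0}$, and has no other singularities. -/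

import Mathlib

open Filter Topology

/-- The Riemann sphere with the three points `0`, `1`, `∞` removed, that is, `ℂ ∖ {0, 1}`. -/
abbrev ThricePuncturedSphere : Type := {z : ℂ // z ≠ 0 ∧ z ≠ 1}

/-- Let `p : X → ℂ ∖ {0, 1}` be a local homeomorphism, so that `p` is a local coordinate on `X`
and `(p, c)` are local coordinates on `X × ℂ`.  A function `F` of two variables on `X × ℂ` is
holomorphic at the point `(x, c)` if near `(x, c)` it is an analytic function of the two
local coordinates. -/
def IsHolomorphicAt {X : Type*} [TopologicalSpace X] (p : X → ThricePuncturedSphere)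
    (F : X → ℂ → ℂ) (x : X) (c : ℂ) : Prop :=
  ∃ G : ℂ × ℂ → ℂ, AnalyticAt ℂ G ((p x : ℂ), c) ∧
    ∀ᶠ q : X × ℂ in 𝓝 (x, c), F q.1 q.2 = G ((p q.1 : ℂ), q.2)

/-- A function `F` of two variables on `X × ℂ` is meromorphic at `(x, c)` if, near `(x, c)`, it is
a quotient `g / h` of two holomorphic functions of the local coordinates `(p, c)`, where `h` does
not vanish identically near `(p x, c)`.  The values of `F` on the zero set of `h` are
irrelevant. -/
def IsMeromorphicAt {X : Type*} [TopologicalSpace X] (p : X → ThricePuncturedSphere)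
    (F : X → ℂ → ℂ) (x : X) (c : ℂ) : Prop :=
  ∃ g h : ℂ × ℂ → ℂ, AnalyticAt ℂ g ((p x : ℂ), c) ∧ AnalyticAt ℂ h ((p x : ℂ), c) ∧
    (∃ᶠ w in 𝓝 ((p x : ℂ), c), h w ≠ 0) ∧
    ∀ᶠ q : X × ℂ in 𝓝 (x, c), h ((p q.1 : ℂ), q.2) ≠ 0 →
      F q.1 q.2 = g ((p q.1 : ℂ), q.2) / h ((p q.1 : ℂ), q.2)

/-! Termwise, `z ∂/∂z + (c - 1)` multiplies `z ^ (k + 1)` by `k + c`, so it sends `Li_{m+1}` to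
`Li_m`; and `Li_0 = z / (1 - z)` is already defined on all of `ℂ ∖ {0, 1}`. The continuation is
therefore built by induction on `m`. On the simply connected `X` there is a global logarithm `ℓ` of
the coordinate up to a constant, and the integrating factor `exp ((c - 1) ℓ)` turns the equation
into the search for a primitive, normalised at `x₀` by the series (`exists_solution`). The primitive
must be jointly holomorphic in the parameter `c`; this is `exists_hasDerivAlong_param`, which rests
on `AnalyticAt.exists_primitive_fst`.

This gives `F` for `c` away from the nonpositive integers. The poles come from splitting off the
first `N` terms: `Li_m(z, c)` is a finite sum plus `z ^ N * Li_m(z, c + N)`, and the identity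
theorem carries this relation to all of `X`. With `N = n + 1` everything is regular at `c = -n`
except `z ^ (n + 1) / (c + n) ^ m`, whose numerator never vanishes on `X`, so the order is exactly
`-m` on every sheet. -/

/-! ### Locally constant functions and gluing -/

/-- A function that is locally constant on an open preconnected set is constant there. -/
theorem IsPreconnected.eq_of_eventually_eq {X Y : Type*} [TopologicalSpace X] {s : Set X}
    (hs : IsPreconnected s) {f : X → Y} (hf : ∀ x ∈ s, ∀ᶠ y in 𝓝 x, f y = f x)
    {x y : X} (hx : x ∈ s) (hy : y ∈ s) : f y = f x := by
  let _ : TopologicalSpace Y := ⊥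
  have : DiscreteTopology Y := ⟨rfl⟩
  refine hs.constant_of_mapsTo (T := Set.univ) (f := f)
    (isDiscrete_iff_discreteTopology.2 inferInstance) (fun z hz => ?_) (Set.mapsTo_univ _ _) hy hx
  refine ContinuousAt.continuousWithinAt ?_
  rw [ContinuousAt, nhds_discrete Y, tendsto_pure]
  exact hf z hz

/-- A predicate that is locally constant on a preconnected space holds everywhere as soon as it
holds at one point. -/
theorem PreconnectedSpace.forall_of_eventually_iff {X : Type*} [TopologicalSpace X]
    [PreconnectedSpace X] {P : X → Prop} (hP : ∀ x, ∀ᶠ y in 𝓝 x, (P y ↔ P x)) {x₀ : X}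
    (h₀ : P x₀) (x : X) : P x := by
  have := isPreconnected_univ.eq_of_eventually_eq (f := P)
    (fun x _ => (hP x).mono fun _ h => propext h) (Set.mem_univ x₀) (Set.mem_univ x)
  rwa [this]

/-- On a simply connected space, local functions whose differences are locally constant can be
glued, up to local constants, to a global function. -/
theorem exists_glue_of_locally_const {X A : Type*} [TopologicalSpace X] [SimplyConnectedSpace X]
    [LocallyPathConnectedSpace X] [AddCommGroup A] (U : X → Set X) (hU : ∀ x, IsOpen (U x))
    (hxU : ∀ x, x ∈ U x) (f : X → X → A)
    (hf : ∀ i j, ∀ x ∈ U i ∩ U j, ∀ᶠ y in 𝓝 x, f i y - f j y = f i x - f j x) (x₀ : X) (a : A) :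
    ∃ H : X → A, H x₀ = a ∧ ∀ i, ∀ x ∈ U i, ∀ᶠ y in 𝓝 x, H y - f i y = H x - f i x := by
  let _ : TopologicalSpace A := ⊥
  have : DiscreteTopology A := ⟨rfl⟩
  -- The fibre coordinate in chart `i` stands for `H - f i`, so passing to chart `j` adds `f i - f
  -- j`. With discrete fibres the total space is a covering, and lifting the identity of `X` gives a
  -- global section.
  let Z : FiberBundleCore X X A :=
    { baseSet := U
      isOpen_baseSet := hU
      indexAt := id
      mem_baseSet_at := hxU
      coordChange := fun i j x v => v + (f i x - f j x)
      coordChange_self := fun i x _ v => by simp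
      continuousOn_coordChange := fun i j => by
        rintro ⟨x, v⟩ ⟨hx, -⟩
        refine ContinuousAt.continuousWithinAt ?_
        have : Tendsto (fun p : X × A => (p.2, f i p.1 - f j p.1)) (𝓝 (x, v))
            (𝓝 (v, f i x - f j x)) := by
          refine Tendsto.prodMk_nhds continuous_snd.continuousAt ?_
          rw [nhds_discrete A, tendsto_pure]
          exact (continuous_fst.tendsto (x, v)).eventually (hf i j x hx)
        exact (continuous_of_discreteTopology (f := fun p : A × A => p.1 + p.2)).continuousAt.tendsto.comp
          this
      coordChange_comp := fun i j k x _ v => by abel }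
  have hcov : IsCoveringMap (Bundle.TotalSpace.proj : Bundle.TotalSpace A Z.Fiber → X) :=
    FiberBundle.isCoveringMap
  obtain ⟨s, ⟨hs₀, hs⟩, -⟩ := hcov.existsUnique_continuousMap_lifts (ContinuousMap.id X) x₀
    (⟨x₀, a - f x₀ x₀⟩ : Bundle.TotalSpace A Z.Fiber) rfl
  have hs' : ∀ x, (s x).proj = x := fun x => congrFun hs x
  let val : Bundle.TotalSpace A Z.Fiber → A := fun t => t.snd
  have hval : ∀ i (t : Bundle.TotalSpace A Z.Fiber),
      (Z.localTriv i t).2 = val t + (f t.proj t.proj - f i t.proj) := fun i t => rfl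
  -- The value stored over `x` is the coordinate in the chart of index `x`; adding `f x x` recovers
  -- `H`.
  refine ⟨fun x => val (s x) + f x x, ?_, fun i x hx => ?_⟩
  · simp only [hs₀, val]
    exact sub_add_cancel _ _
  · have hc : ContinuousAt (fun y => (Z.localTriv i (s y)).2) x := by
      refine continuous_snd.continuousAt.comp (ContinuousAt.comp ?_ s.continuous.continuousAt)
      refine (Z.localTriv i).continuousAt ?_
      rw [Z.mem_localTriv_source, hs' x]
      exact hx
    rw [ContinuousAt, nhds_discrete A, tendsto_pure] at hc
    filter_upwards [hc] with y hy
    rw [hval, hval, hs', hs'] at hy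
    rw [add_sub_assoc, add_sub_assoc]
    exact hy

/-! ### One-variable calculus in a local coordinate -/

section Along

variable {X : Type*} [TopologicalSpace X] {q : X → ℂ}

/-- `f` has derivative `f'` at `x` with respect to the local coordinate `q`. -/
def HasDerivAlong (q : X → ℂ) (f : X → ℂ) (f' : ℂ) (x : X) : Prop :=
  ∃ G : ℂ → ℂ, HasDerivAt G f' (q x) ∧ ∀ᶠ y in 𝓝 x, f y = G (q y)

/-- `f` is analytic at `x` with respect to the local coordinate `q`. -/
def AnalyticAlong (q : X → ℂ) (f : X → ℂ) (x : X) : Prop :=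
  ∃ G : ℂ → ℂ, AnalyticAt ℂ G (q x) ∧ ∀ᶠ y in 𝓝 x, f y = G (q y)

theorem HasDerivAlong.sub {f g : X → ℂ} {f' g' : ℂ} {x : X} (hf : HasDerivAlong q f f' x)
    (hg : HasDerivAlong q g g' x) : HasDerivAlong q (fun y => f y - g y) (f' - g') x := by
  obtain ⟨F, hF, hf⟩ := hf
  obtain ⟨G, hG, hg⟩ := hg
  exact ⟨fun z => F z - G z, hF.sub hG, by filter_upwards [hf, hg] with y h1 h2; rw [h1, h2]⟩

theorem HasDerivAlong.mul {f g : X → ℂ} {f' g' : ℂ} {x : X}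
    (hf : HasDerivAlong q f f' x) (hg : HasDerivAlong q g g' x) :
    HasDerivAlong q (fun y => f y * g y) (f' * g x + f x * g') x := by
  obtain ⟨F, hF, hf⟩ := hf
  obtain ⟨G, hG, hg⟩ := hg
  refine ⟨fun z => F z * G z, ?_, by filter_upwards [hf, hg] with y h1 h2; rw [h1, h2]⟩
  rw [hf.self_of_nhds, hg.self_of_nhds]
  exact hF.mul hG

theorem HasDerivAlong.comp {f : X → ℂ} {f' g' : ℂ} {g : ℂ → ℂ} {x : X}
    (hg : HasDerivAt g g' (f x)) (hf : HasDerivAlong q f f' x) :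
    HasDerivAlong q (fun y => g (f y)) (g' * f') x := by
  obtain ⟨F, hF, hf⟩ := hf
  refine ⟨fun z => g (F z), ?_, by filter_upwards [hf] with y h1; rw [h1]⟩
  rw [hf.self_of_nhds] at hg
  exact hg.comp (q x) hF

/-- A function with vanishing derivative along a local homeomorphism is locally constant. -/
theorem IsLocalHomeomorph.eventually_eq_of_hasDerivAlong_zero (hq : IsLocalHomeomorph q)
    {f : X → ℂ} {x : X} (hf : ∀ᶠ y in 𝓝 x, HasDerivAlong q f 0 y) :
    ∀ᶠ y in 𝓝 x, f y = f x := by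
  obtain ⟨e, hxe, rfl⟩ := hq x
  have hsymm : ∀ᶠ w in 𝓝 (e x), HasDerivAt (fun w => f (e.symm w)) 0 w := by
    have h1 : ∀ᶠ w in 𝓝 (e x), HasDerivAlong e f 0 (e.symm w) :=
      (e.tendsto_symm hxe).eventually hf
    filter_upwards [h1, e.open_target.mem_nhds (e.map_source hxe)] with w hw hwt
    obtain ⟨G, hG, hfG⟩ := hw
    rw [e.right_inv hwt] at hG
    refine hG.congr_of_eventuallyEq ?_
    filter_upwards [(e.symm.continuousAt hwt).eventually hfG, e.open_target.mem_nhds hwt]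
      with v hv hvt
    rw [hv, e.right_inv hvt]
  obtain ⟨r, hr, hball⟩ := Metric.eventually_nhds_iff_ball.1 hsymm
  have hxs : e.symm (e x) = x := e.left_inv hxe
  have hb : e x ∈ Metric.ball (e x) r := Metric.mem_ball_self hr
  filter_upwards [e.open_source.mem_nhds hxe,
    (e.continuousAt hxe).eventually (Metric.ball_mem_nhds (e x) hr)] with y hys hyb
  have := Metric.isOpen_ball.is_const_of_deriv_eq_zero (convex_ball (e x) r).isPreconnected
    (fun w hw => (hball w hw).differentiableAt.differentiableWithinAt)
    (fun w hw => (hball w hw).deriv) hyb hb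
  simpa [e.left_inv hys, hxs] using this

theorem IsLocalHomeomorph.eqOn_of_hasDerivAlong_zero (hq : IsLocalHomeomorph q)
    {s : Set X} (hs : IsPreconnected s) (hso : IsOpen s) {f : X → ℂ}
    (hf : ∀ x ∈ s, HasDerivAlong q f 0 x) {x y : X} (hx : x ∈ s) (hy : y ∈ s) : f y = f x :=
  hs.eq_of_eventually_eq (fun _ hx => hq.eventually_eq_of_hasDerivAlong_zero
    ((hso.eventually_mem hx).mono hf)) hx hy

/-- On a simply connected space with a local coordinate `q`, an analytic function has a
primitive. -/
theorem IsLocalHomeomorph.exists_hasDerivAlong [SimplyConnectedSpace X]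
    [LocallyPathConnectedSpace X] (hq : IsLocalHomeomorph q) {g : X → ℂ}
    (hg : ∀ x, AnalyticAlong q g x) (x₀ : X) (a : ℂ) :
    ∃ H : X → ℂ, H x₀ = a ∧ ∀ x, HasDerivAlong q H (g x) x := by
  have hloc : ∀ x, ∃ U : Set X, IsOpen U ∧ x ∈ U ∧ ∃ P : ℂ → ℂ, ∀ y ∈ U,
      HasDerivAt P (g y) (q y) := by
    intro x
    obtain ⟨G, hG, hgG⟩ := hg x
    obtain ⟨r, hr, hball⟩ := Metric.eventually_nhds_iff_ball.1 hG.eventually_analyticAt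
    obtain ⟨P, hP⟩ := DifferentiableOn.isExactOn_ball (f := G) (c := q x) (r := r)
      (fun w hw => (hball w hw).differentiableAt.differentiableWithinAt)
    have h := hgG.and (hq.continuous.continuousAt.eventually (Metric.ball_mem_nhds (q x) hr))
    obtain ⟨U, hU, hUo, hxU⟩ := eventually_nhds_iff.1 h
    refine ⟨U, hUo, hxU, P, fun y hy => ?_⟩
    rw [(hU y hy).1]
    exact hP _ (hU y hy).2
  choose U hUo hxU P hP using hloc
  obtain ⟨H, hH₀, hH⟩ := exists_glue_of_locally_const U hUo hxU (fun i y => P i (q y))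
    (fun i j x hx => by
      refine hq.eventually_eq_of_hasDerivAlong_zero (f := fun y => P i (q y) - P j (q y)) ?_
      filter_upwards [((hUo i).inter (hUo j)).mem_nhds hx] with y hy
      have h1 : HasDerivAlong q (fun y => P i (q y)) (g y) y := ⟨P i, hP i y hy.1, by simp⟩
      have h2 : HasDerivAlong q (fun y => P j (q y)) (g y) y := ⟨P j, hP j y hy.2, by simp⟩
      simpa using h1.sub h2) x₀ a
  refine ⟨H, hH₀, fun x => ⟨fun z => P x z + (H x - P x (q x)), (hP x x (hxU x)).add_const _, ?_⟩⟩
  filter_upwards [hH x x (hxU x)] with y hy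
  linear_combination hy

end Along

/-! ### Local primitives in one of two variables -/

section TwoVariables

open Metric Complex

/-- The normalised integral over a circle of a continuous function on that circle. -/
noncomputable def circleIntegralCLM (c : ℂ) {R : ℝ} (hR : 0 < R) :
    C(sphere c R, ℂ) →L[ℂ] ℂ :=
  LinearMap.mkContinuous
    { toFun := fun f => (2 * Real.pi * I)⁻¹ *
        ∫ θ in (0 : ℝ)..2 * Real.pi, deriv (circleMap c R) θ *
          f ⟨circleMap c R θ, circleMap_mem_sphere c hR.le θ⟩
      map_add' := fun f g => by
        rw [← mul_add, ← intervalIntegral.integral_add]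
        · simp [mul_add]
        all_goals
          apply Continuous.intervalIntegrable
          simp only [deriv_circleMap]
          fun_prop
      map_smul' := fun a f => by
        simp only [ContinuousMap.coe_smul, Pi.smul_apply, smul_eq_mul, RingHom.id_apply]
        simp only [mul_left_comm _ a, intervalIntegral.integral_const_mul] }
    (‖(2 * Real.pi * I : ℂ)⁻¹‖ * (R * |2 * Real.pi - 0|)) fun f => by
      simp only [LinearMap.coe_mk, AddHom.coe_mk]
      rw [norm_mul, mul_assoc ‖_‖ _ ‖f‖, mul_right_comm R]
      refine mul_le_mul_of_nonneg_left ?_ (norm_nonneg _)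
      refine intervalIntegral.norm_integral_le_of_norm_le_const fun θ _ => ?_
      rw [norm_mul]
      refine mul_le_mul ?_ (f.norm_coe_le_norm _) (norm_nonneg _) hR.le
      simp [deriv_circleMap, abs_of_pos hR]

theorem circleIntegralCLM_eq {c : ℂ} {R : ℝ} (hR : 0 < R) (f : C(sphere c R, ℂ)) (g : ℂ → ℂ)
    (h : ∀ z (hz : z ∈ sphere c R), f ⟨z, hz⟩ = g z) :
    circleIntegralCLM c hR f = (2 * Real.pi * I)⁻¹ • ∮ z in C(c, R), g z := by
  simp [circleIntegralCLM, circleIntegral, h]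

/-- Analyticity of `c ↦ G (·, c)` as a map into a Banach space follows from its Cauchy integral over
a circle in `c`, which has a power series; evaluation at each point of the sphere reduces the
identification to the scalar Cauchy formula. -/
theorem exists_analytic_circle_section {G : ℂ × ℂ → ℂ} {z₀ c₀ : ℂ} {R : ℝ} (hR : 0 < R)
    (hG : ∀ z ∈ closedBall z₀ R, ∀ c ∈ closedBall c₀ R, AnalyticAt ℂ G (z, c)) :
    ∃ v : ℂ → C(sphere z₀ R, ℂ), AnalyticOnNhd ℂ v (ball c₀ R) ∧
      ∀ c ∈ ball c₀ R, ∀ z : sphere z₀ R, v c z = G (z, c) := by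
  have hGc : ContinuousOn G (closedBall z₀ R ×ˢ closedBall c₀ R) := fun w hw =>
    (hG w.1 hw.1 w.2 hw.2).continuousAt.continuousWithinAt
  -- Tietze extension, so that the curried map `γ` is continuous on all of `ℂ`.
  obtain ⟨g, hg⟩ := ContinuousMap.exists_restrict_eq
    (isClosed_closedBall.prod isClosed_closedBall) ⟨_, hGc.domRestrict⟩
  have hg' : ∀ z ∈ closedBall z₀ R, ∀ c ∈ closedBall c₀ R, g (z, c) = G (z, c) :=
    fun z hz c hc => congrArg (fun f => f ⟨(z, c), ⟨hz, hc⟩⟩) hg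
  let γ : C(ℂ, C(sphere z₀ R, ℂ)) :=
    ContinuousMap.curry ⟨fun p : ℂ × sphere z₀ R => g (p.2, p.1), by fun_prop⟩
  lift R to NNReal using hR.le
  have hint : CircleIntegrable γ c₀ R := γ.continuous.continuousOn.circleIntegrable hR.le
  have hps := hasFPowerSeriesOn_cauchy_integral hint (by exact_mod_cast hR)
  refine ⟨_, fun c hc => hps.analyticAt_of_mem ?_, fun c hc z => ?_⟩
  · rw [Metric.eball_coe]
    exact hc
  · have hzs : (z : ℂ) ∈ closedBall z₀ R := sphere_subset_closedBall z.2
    have hd : DiffContOnCl ℂ (fun c => G (z, c)) (ball c₀ R) := by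
      refine DifferentiableOn.diffContOnCl fun c hc => ?_
      rw [closure_ball _ hR.ne'] at hc
      exact ((hG z hzs c hc).comp₂ analyticAt_const analyticAt_id).differentiableAt.differentiableWithinAt
    rw [← hd.two_pi_i_inv_smul_circleIntegral_sub_inv_smul hc]
    change ContinuousMap.evalCLM ℂ z ((2 * Real.pi * I : ℂ)⁻¹ • ∮ w in C(c₀, R), (w - c)⁻¹ • γ w) = _
    rw [map_smul, circleIntegral, ← ContinuousLinearMap.intervalIntegral_comp_comm]
    · congr 1
      refine intervalIntegral.integral_congr fun θ _ => ?_
      have := hg' z hzs (circleMap c₀ R θ)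
        (sphere_subset_closedBall (circleMap_mem_sphere c₀ hR.le θ))
      simp [ContinuousMap.evalCLM, γ, this]
    · have : ContinuousOn (fun z => (z - c)⁻¹ • γ z) (sphere c₀ R) := by
        refine ContinuousOn.smul (ContinuousOn.inv₀ (continuousOn_id.sub continuousOn_const) fun w hw => ?_)
          γ.continuous.continuousOn
        refine sub_ne_zero.2 ?_
        rintro rfl
        exact (mem_ball.1 hc).ne hw
      exact (this.circleIntegrable hR.le).out

/-- Holomorphic functions of two variables have local holomorphic primitives in the first
variable. -/
theorem AnalyticAt.exists_primitive_fst {G : ℂ × ℂ → ℂ} {w₀ : ℂ × ℂ} (hG : AnalyticAt ℂ G w₀) :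
    ∃ K : ℂ × ℂ → ℂ, AnalyticAt ℂ K w₀ ∧
      ∀ᶠ w in 𝓝 w₀, HasDerivAt (fun z => K (z, w.2)) (G w) w.1 := by
  obtain ⟨z₀, c₀⟩ := w₀
  obtain ⟨R, hR, hball⟩ := nhds_basis_closedBall.eventually_iff.1 hG.eventually_analyticAt
  have hGb : ∀ z ∈ closedBall z₀ R, ∀ c ∈ closedBall c₀ R, AnalyticAt ℂ G (z, c) := by
    intro z hz c hc
    exact hball (by rw [← closedBall_prod_same]; exact ⟨hz, hc⟩)
  obtain ⟨v, hv, hvG⟩ := exists_analytic_circle_section hR hGb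
  let ι : C(sphere z₀ R, ℂ) := ⟨fun z => z, continuous_subtype_val⟩
  -- The Cauchy kernel `ζ ↦ (ζ - z)⁻¹` as an element of the Banach algebra. Cauchy's formula then
  -- reads `G (z, c) = L (u z * v c)` with `L` continuous linear: the variables separate, and only
  -- `u` has to be integrated.
  let u : ℂ → C(sphere z₀ R, ℂ) := fun z => Ring.inverse (ι - algebraMap ℂ C(sphere z₀ R, ℂ) z)
  have hunit : ∀ z ∈ ball z₀ R, ∃ U : C(sphere z₀ R, ℂ)ˣ,
      (U : C(sphere z₀ R, ℂ)) = ι - algebraMap ℂ C(sphere z₀ R, ℂ) z := by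
    intro z hz
    have : ∀ ζ : sphere z₀ R, (ζ : ℂ) - z ≠ 0 := fun ζ => by
      rw [sub_ne_zero]
      rintro rfl
      exact (mem_ball.1 hz).ne ζ.2
    refine ⟨⟨ι - algebraMap ℂ _ z, ⟨fun ζ => ((ζ : ℂ) - z)⁻¹, ?_⟩, ?_, ?_⟩, rfl⟩
    · exact Continuous.inv₀ (by fun_prop) this
    · ext ζ
      exact mul_inv_cancel₀ (this ζ)
    · ext ζ
      exact inv_mul_cancel₀ (this ζ)
  have hu : ∀ z ∈ ball z₀ R, AnalyticAt ℂ u z := by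
    intro z hz
    obtain ⟨U, hU⟩ := hunit z hz
    have h1 : AnalyticAt ℂ (fun z : ℂ => ι - algebraMap ℂ C(sphere z₀ R, ℂ) z) z :=
      analyticAt_const.sub ((Algebra.linearMap ℂ C(sphere z₀ R, ℂ)).toContinuousLinearMap.analyticAt z)
    have h2 := analyticAt_inverse (𝕜 := ℂ) U
    rw [hU] at h2
    exact AnalyticAt.comp (f := fun z : ℂ => ι - algebraMap ℂ C(sphere z₀ R, ℂ) z) h2 h1
  have hu' : ∀ z ∈ ball z₀ R, ∀ ζ : sphere z₀ R, u z ζ = ((ζ : ℂ) - z)⁻¹ := by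
    intro z hz ζ
    obtain ⟨U, hU⟩ := hunit z hz
    have h1 : u z * (ι - algebraMap ℂ C(sphere z₀ R, ℂ) z) = 1 := by
      simp only [u, ← hU, Ring.inverse_unit, Units.inv_mul]
    exact eq_inv_of_mul_eq_one_left (congrArg (fun f => f ζ) h1)
  obtain ⟨P, hP⟩ := DifferentiableOn.isExactOn_ball (f := u) (c := z₀) (r := R)
    fun z hz => (hu z hz).differentiableAt.differentiableWithinAt
  have hPa : AnalyticAt ℂ P z₀ :=
    DifferentiableOn.analyticAt (s := ball z₀ R)
      (fun z hz => (hP z hz).differentiableAt.differentiableWithinAt) (ball_mem_nhds z₀ hR)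
  refine ⟨fun w => circleIntegralCLM z₀ hR (P w.1 * v w.2), ?_, ?_⟩
  · refine ((circleIntegralCLM z₀ hR).analyticAt _).comp (AnalyticAt.mul ?_ ?_)
    · exact AnalyticAt.comp (f := Prod.fst) (x := (z₀, c₀)) hPa analyticAt_fst
    · exact AnalyticAt.comp (f := Prod.snd) (x := (z₀, c₀)) (hv c₀ (mem_ball_self hR))
        analyticAt_snd
  · have hmem : ball z₀ R ×ˢ ball c₀ R ∈ 𝓝 (z₀, c₀) :=
      prod_mem_nhds (ball_mem_nhds z₀ hR) (ball_mem_nhds c₀ hR)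
    filter_upwards [hmem] with w hw
    obtain ⟨z, c⟩ := w
    have hd := (circleIntegralCLM z₀ hR).hasFDerivAt.comp_hasDerivAt z
      ((hP z hw.1).mul_const (v c))
    have heq : circleIntegralCLM z₀ hR (u z * v c) = G (z, c) := by
      rw [circleIntegralCLM_eq hR _ (fun ζ => (ζ - z)⁻¹ • G (ζ, c))]
      · have hdc : DiffContOnCl ℂ (fun z => G (z, c)) (ball z₀ R) := by
          refine DifferentiableOn.diffContOnCl fun z hz => ?_
          rw [closure_ball _ hR.ne'] at hz
          exact ((hGb z hz c (ball_subset_closedBall hw.2)).comp₂ analyticAt_id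
            analyticAt_const).differentiableAt.differentiableWithinAt
        exact hdc.two_pi_i_inv_smul_circleIntegral_sub_inv_smul hw.1
      · intro ζ hζ
        rw [ContinuousMap.mul_apply, hu' z hw.1, hvG c hw.2, smul_eq_mul]
    rw [heq] at hd
    exact hd

end TwoVariables

/-! ### Primitives with a parameter, the differential equation, the identity theorem -/

section ParametricPrimitive

variable {X : Type*} [TopologicalSpace X] {q : X → ℂ}

/-- `F` is analytic at `(x, c)` as a function of the local coordinate `q` and of the second
variable. -/
def AnalyticAlong₂ (q : X → ℂ) (F : X → ℂ → ℂ) (x : X) (c : ℂ) : Prop :=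
  ∃ G : ℂ × ℂ → ℂ, AnalyticAt ℂ G (q x, c) ∧
    ∀ᶠ r : X × ℂ in 𝓝 (x, c), F r.1 r.2 = G (q r.1, r.2)

theorem AnalyticAt.analyticAlong₂ {G : ℂ × ℂ → ℂ} {x : X} {c : ℂ} (hG : AnalyticAt ℂ G (q x, c)) :
    AnalyticAlong₂ q (fun y d => G (q y, d)) x c :=
  ⟨G, hG, by simp⟩

theorem AnalyticAlong₂.mul {F₁ F₂ : X → ℂ → ℂ} {x : X} {c : ℂ} (h₁ : AnalyticAlong₂ q F₁ x c)
    (h₂ : AnalyticAlong₂ q F₂ x c) : AnalyticAlong₂ q (fun y d => F₁ y d * F₂ y d) x c := by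
  obtain ⟨G₁, hG₁, h₁⟩ := h₁
  obtain ⟨G₂, hG₂, h₂⟩ := h₂
  exact ⟨fun w => G₁ w * G₂ w, hG₁.mul hG₂, by filter_upwards [h₁, h₂] with r e₁ e₂; rw [e₁, e₂]⟩

theorem AnalyticAlong₂.add {F₁ F₂ : X → ℂ → ℂ} {x : X} {c : ℂ} (h₁ : AnalyticAlong₂ q F₁ x c)
    (h₂ : AnalyticAlong₂ q F₂ x c) : AnalyticAlong₂ q (fun y d => F₁ y d + F₂ y d) x c := by
  obtain ⟨G₁, hG₁, h₁⟩ := h₁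
  obtain ⟨G₂, hG₂, h₂⟩ := h₂
  exact ⟨fun w => G₁ w + G₂ w, hG₁.add hG₂, by filter_upwards [h₁, h₂] with r e₁ e₂; rw [e₁, e₂]⟩

theorem AnalyticAlong₂.comp {F : X → ℂ → ℂ} {g : ℂ → ℂ} {x : X} {c : ℂ}
    (hg : AnalyticAt ℂ g (F x c)) (h : AnalyticAlong₂ q F x c) :
    AnalyticAlong₂ q (fun y d => g (F y d)) x c := by
  obtain ⟨G, hG, h⟩ := h
  have h0 := h.self_of_nhds
  simp only at h0
  rw [h0] at hg
  exact ⟨fun w => g (G w), hg.comp hG, by filter_upwards [h] with r e; rw [e]⟩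

theorem AnalyticAlong₂.analyticAlong {F : X → ℂ → ℂ} {x : X} {c : ℂ}
    (h : AnalyticAlong₂ q F x c) : AnalyticAlong q (fun y => F y c) x := by
  obtain ⟨G, hG, h⟩ := h
  exact ⟨fun z => G (z, c), hG.comp₂ analyticAt_id analyticAt_const,
    (Continuous.prodMk_left c).continuousAt.eventually h⟩

theorem AnalyticAlong₂.analyticAt {F : X → ℂ → ℂ} {x : X} {c : ℂ}
    (h : AnalyticAlong₂ q F x c) : AnalyticAt ℂ (F x) c := by
  obtain ⟨G, hG, h⟩ := h
  have h1 : AnalyticAt ℂ (fun d => G (q x, d)) c := hG.comp₂ analyticAt_const analyticAt_id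
  refine h1.congr ?_
  filter_upwards [(Continuous.prodMk_right x).continuousAt.eventually h] with d hd
  exact hd.symm

theorem AnalyticAlong.analyticAlong₂ {f : X → ℂ} {x : X} (h : AnalyticAlong q f x) (c : ℂ) :
    AnalyticAlong₂ q (fun y _ => f y) x c := by
  obtain ⟨G, hG, h⟩ := h
  exact ⟨fun w => G w.1, AnalyticAt.comp (f := Prod.fst) (x := (q x, c)) hG analyticAt_fst,
    (continuous_fst.tendsto (x, c)).eventually h⟩

/-- Primitives of analytic functions depending analytically on a parameter. -/
theorem IsLocalHomeomorph.exists_hasDerivAlong_param [SimplyConnectedSpace X]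
    [LocallyPathConnectedSpace X] (hq : IsLocalHomeomorph q) {U : Set ℂ} (hU : IsOpen U)
    {h : X → ℂ → ℂ} (hh : ∀ x, ∀ c ∈ U, AnalyticAlong₂ q h x c) (x₀ : X) {a : ℂ → ℂ}
    (ha : ∀ c ∈ U, AnalyticAt ℂ a c) :
    ∃ H : X → ℂ → ℂ, (∀ c ∈ U, H x₀ c = a c) ∧
      (∀ x, ∀ c ∈ U, HasDerivAlong q (fun y => H y c) (h x c) x) ∧
      ∀ x, ∀ c ∈ U, AnalyticAlong₂ q H x c := by
  have hex : ∀ c, ∃ H : X → ℂ, c ∈ U → (H x₀ = a c ∧ ∀ x, HasDerivAlong q H (h x c) x) := by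
    intro c
    by_cases hc : c ∈ U
    · obtain ⟨H, hH⟩ := hq.exists_hasDerivAlong (fun x => (hh x c hc).analyticAlong) x₀ (a c)
      exact ⟨H, fun _ => hH⟩
    · exact ⟨0, fun h => absurd h hc⟩
  choose H hH using hex
  -- The primitives were chosen independently for each `d`, but their increments over a connected
  -- `V`, which serves all `d` near `c`, are those of the jointly analytic `K`.
  have hloc : ∀ x, ∀ c ∈ U, ∃ V : Set X, IsOpen V ∧ x ∈ V ∧ ∃ K : ℂ × ℂ → ℂ,
      (∀ y ∈ V, AnalyticAt ℂ K (q y, c)) ∧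
      ∀ᶠ d in 𝓝 c, ∀ y ∈ V, H d y = H d x + (K (q y, d) - K (q x, d)) := by
    intro x c hc
    obtain ⟨G, hG, hhG⟩ := hh x c hc
    obtain ⟨K, hK, hKG⟩ := hG.exists_primitive_fst
    have hcont : Tendsto (fun r : X × ℂ => (q r.1, r.2)) (𝓝 (x, c)) (𝓝 (q x, c)) :=
      ((hq.continuous.comp continuous_fst).prodMk continuous_snd).tendsto (x, c)
    have hUe : ∀ᶠ r : X × ℂ in 𝓝 (x, c), r.2 ∈ U :=
      (continuous_snd.tendsto (x, c)).eventually (hU.eventually_mem hc)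
    have hev := (hhG.eventually_nhds.and (hcont.eventually hKG)).and hUe
    rw [nhds_prod_eq, eventually_prod_iff] at hev
    obtain ⟨pa, hpa, pb, hpb, hab⟩ := hev
    have hKa : ∀ᶠ y in 𝓝 x, AnalyticAt ℂ K (q y, c) :=
      ((hq.continuous.prodMk continuous_const).tendsto x).eventually hK.eventually_analyticAt
    obtain ⟨V, ⟨hVo, hxV, hVc⟩, hV⟩ :=
      (LocallyConnectedSpace.open_connected_basis x).mem_iff.1 (hpa.and hKa)
    refine ⟨V, hVo, hxV, K, fun y hy => (hV hy).2, ?_⟩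
    filter_upwards [hpb] with d hd y hy
    have := hq.eqOn_of_hasDerivAlong_zero hVc.isPreconnected hVo
      (f := fun y => H d y - K (q y, d)) (fun y hy => ?_) hxV hy
    · linear_combination this
    · obtain ⟨⟨h1, h2⟩, h3⟩ := hab (hV hy).1 hd
      have h4 := (hH d h3).2 y
      have h5 : HasDerivAlong q (fun y => K (q y, d)) (G (q y, d)) y :=
        ⟨fun z => K (z, d), h2, by simp⟩
      have h6 := h4.sub h5
      rw [h1.self_of_nhds, sub_self] at h6
      exact h6
  -- Analyticity in the parameter holds at `x₀` by the choice of `a` and spreads over the connected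
  -- `X`, since increments in `x` are analytic in `d`.
  have hAn : ∀ c ∈ U, ∀ x, AnalyticAt ℂ (fun d => H d x) c := by
    intro c hc
    refine PreconnectedSpace.forall_of_eventually_iff (x₀ := x₀) (fun x => ?_) ?_
    · obtain ⟨V, hVo, hxV, K, hK, hHK⟩ := hloc x c hc
      have hKd : ∀ y ∈ V, AnalyticAt ℂ (fun d => K (q y, d)) c := fun y hy =>
        (hK y hy).comp₂ analyticAt_const analyticAt_id
      filter_upwards [hVo.mem_nhds hxV] with y hy
      constructor
      · intro h1
        refine (h1.sub ((hKd y hy).sub (hKd x hxV))).congr ?_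
        filter_upwards [hHK] with d hd
        simp [hd y hy]
      · intro h1
        refine (h1.add ((hKd y hy).sub (hKd x hxV))).congr ?_
        filter_upwards [hHK] with d hd
        simp [hd y hy]
    · refine (ha c hc).congr ?_
      filter_upwards [hU.mem_nhds hc] with d hd
      exact (hH d hd).1.symm
  refine ⟨fun x c => H c x, fun c hc => (hH c hc).1, fun x c hc => (hH c hc).2 x,
    fun x c hc => ?_⟩
  obtain ⟨V, hVo, hxV, K, hK, hHK⟩ := hloc x c hc
  have h1 : AnalyticAt ℂ (fun d => H d x - K (q x, d)) c :=
    (hAn c hc x).sub ((hK x hxV).comp₂ analyticAt_const analyticAt_id)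
  refine ⟨fun w => (H w.2 x - K (q x, w.2)) + K w, ?_, ?_⟩
  · exact (AnalyticAt.comp (f := Prod.snd) (x := (q x, c)) h1 analyticAt_snd).add (hK x hxV)
  · rw [nhds_prod_eq]
    filter_upwards [(hVo.eventually_mem hxV).prod_mk hHK] with r hr
    rw [hr.2 _ hr.1]
    ring

/-- A nowhere vanishing local coordinate has a global logarithmic primitive. -/
theorem IsLocalHomeomorph.exists_log [SimplyConnectedSpace X]
    [LocallyPathConnectedSpace X] (hq : IsLocalHomeomorph q) (hq0 : ∀ x, q x ≠ 0) :
    ∃ ℓ : X → ℂ, (∀ x, AnalyticAlong q ℓ x) ∧ (∀ x, HasDerivAlong q ℓ (q x)⁻¹ x) := by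
  obtain ⟨x₀⟩ : Nonempty X := inferInstance
  obtain ⟨H, -, hH, hHa⟩ := hq.exists_hasDerivAlong_param isOpen_univ
    (h := fun x _ => (q x)⁻¹) (fun x c _ =>
      AnalyticAt.analyticAlong₂ (G := fun w => w.1⁻¹) (analyticAt_fst.inv (hq0 x))) x₀
    (a := 0) (fun c _ => analyticAt_const)
  exact ⟨fun x => H x 0, fun x => (hHa x 0 trivial).analyticAlong, fun x => hH x 0 trivial⟩

/-- Solving `q ∂F/∂q + (c - 1) F = F'` on a simply connected space, with prescribed values on an
open connected set where a solution `s` is already known. -/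
theorem IsLocalHomeomorph.exists_solution [SimplyConnectedSpace X]
    [LocallyPathConnectedSpace X] (hq : IsLocalHomeomorph q) (hq0 : ∀ x, q x ≠ 0)
    {U : Set ℂ} (hU : IsOpen U) {Ω : Set X} (hΩ : IsPreconnected Ω) (hΩo : IsOpen Ω) {x₀ : X}
    (hx₀ : x₀ ∈ Ω) {F' : X → ℂ → ℂ} (hF' : ∀ x, ∀ c ∈ U, AnalyticAlong₂ q F' x c)
    {s : ℂ → ℂ → ℂ} (hs₀ : ∀ c ∈ U, AnalyticAt ℂ (s (q x₀)) c)
    (hs : ∀ x ∈ Ω, ∀ c ∈ U,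
      HasDerivAt (fun z => s z c) ((F' x c - (c - 1) * s (q x) c) / q x) (q x)) :
    ∃ F : X → ℂ → ℂ, (∀ x, ∀ c ∈ U, AnalyticAlong₂ q F x c) ∧
      ∀ x ∈ Ω, ∀ c ∈ U, F x c = s (q x) c := by
  obtain ⟨ℓ, hℓa, hℓ⟩ := hq.exists_log hq0
  -- A branch of `q ^ (c - 1)` up to a factor depending only on `c`; the equation becomes `∂(E F)/∂q
  -- = E F' / q`.
  let E : X → ℂ → ℂ := fun x c => Complex.exp ((c - 1) * ℓ x)
  have hcoord : ∀ x c, AnalyticAlong₂ q (fun _ d => d - 1) x c := fun x c =>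
    AnalyticAt.analyticAlong₂ (G := fun w => w.2 - 1) (analyticAt_snd.sub analyticAt_const)
  have hEa : ∀ x c, AnalyticAlong₂ q E x c := fun x c =>
    AnalyticAlong₂.comp (g := Complex.exp) analyticAt_cexp
      ((hcoord x c).mul ((hℓa x).analyticAlong₂ c))
  have hE0 : ∀ x c, E x c ≠ 0 := fun x c => Complex.exp_ne_zero _
  have hEd : ∀ x c, HasDerivAlong q (fun y => E y c) (E x c * ((c - 1) * (q x)⁻¹)) x := fun x c => by
    have h1 : HasDerivAt (fun w => Complex.exp ((c - 1) * w)) (E x c * (c - 1)) (ℓ x) := by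
      simpa using ((hasDerivAt_id (ℓ x)).const_mul (c - 1)).cexp
    have h2 := HasDerivAlong.comp h1 (hℓ x)
    rwa [mul_assoc] at h2
  obtain ⟨H, hH₀, hH, hHa⟩ := hq.exists_hasDerivAlong_param hU
    (h := fun x c => E x c * F' x c * (q x)⁻¹)
    (fun x c hc => ((hEa x c).mul (hF' x c hc)).mul
      (AnalyticAt.analyticAlong₂ (G := fun w => w.1⁻¹) (analyticAt_fst.inv (hq0 x)))) x₀
    (a := fun c => E x₀ c * s (q x₀) c)
    (fun c hc => (hEa x₀ c).analyticAt.mul (hs₀ c hc))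
  refine ⟨fun x c => (E x c)⁻¹ * H x c, fun x c hc =>
    (AnalyticAlong₂.comp (g := fun w => w⁻¹) (analyticAt_inv (hE0 x c)) (hEa x c)).mul (hHa x c hc),
    fun x hx c hc => ?_⟩
  -- On `Ω` both `H` and `E s` are primitives of `E F' / q`, and they agree at `x₀`.
  have key := hq.eqOn_of_hasDerivAlong_zero hΩ hΩo
    (f := fun y => H y c - E y c * s (q y) c) (fun y hy => ?_) hx₀ hx
  · simp only [hH₀ c hc, sub_self, sub_eq_zero] at key
    simp only [key, inv_mul_cancel_left₀ (hE0 x c)]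
  · have h1 : HasDerivAlong q (fun y => s (q y) c) _ y := ⟨fun z => s z c, hs y hy c hc, by simp⟩
    have h2 := (hH y c hc).sub ((hEd y c).mul h1)
    convert h2 using 1
    field_simp [hq0 y]
    ring

/-- Identity theorem along a local coordinate. -/
theorem IsLocalHomeomorph.eq_zero_of_eventually_eq_zero [PreconnectedSpace X]
    (hq : IsLocalHomeomorph q) {f : X → ℂ} (hf : ∀ x, AnalyticAlong q f x) {x₀ : X}
    (h₀ : ∀ᶠ y in 𝓝 x₀, f y = 0) (x : X) : f x = 0 := by
  refine Eventually.self_of_nhds (p := fun y => f y = 0) ?_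
  refine PreconnectedSpace.forall_of_eventually_iff (P := fun x => ∀ᶠ y in 𝓝 x, f y = 0)
    (fun x => ?_) h₀ x
  obtain ⟨G, hG, hfG⟩ := hf x
  rcases hG.eventually_eq_zero_or_eventually_ne_zero with h | h
  · have h1 : ∀ᶠ y in 𝓝 x, f y = 0 := by
      filter_upwards [hfG, hq.continuous.continuousAt.eventually h] with y e1 e2
      rw [e1, e2]
    filter_upwards [h1.eventually_nhds] with y hy
    exact ⟨fun _ => h1, fun _ => hy⟩
  · obtain ⟨e, hxe, rfl⟩ := hq x
    have h1 : ∀ᶠ y in 𝓝 x, y ≠ x → f y ≠ 0 := by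
      rw [eventually_nhdsWithin_iff] at h
      filter_upwards [hfG, (e.continuousAt hxe).eventually h, e.open_source.mem_nhds hxe]
        with y e1 e2 hy hne
      rw [e1]
      exact e2 fun heq => hne (e.injOn hy hxe heq)
    -- Otherwise `x` would be isolated, which a chart to `ℂ` forbids.
    have h2 : ¬ ∀ᶠ y in 𝓝 x, f y = 0 := by
      intro h3
      have h4 : ∀ᶠ w in 𝓝 (e x), e.symm w = x := by
        filter_upwards [(e.tendsto_symm hxe).eventually h3, (e.tendsto_symm hxe).eventually h1]
          with w h5 h6
        by_contra hne
        exact h6 hne h5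
      have h7 : ∀ᶠ w in 𝓝 (e x), w = e x := by
        filter_upwards [h4, e.open_target.mem_nhds (e.map_source hxe)] with w h5 h6
        rw [← h5, e.right_inv h6]
      exact (NeBot.ne (inferInstance : (𝓝[≠] (e x)).NeBot))
        (by rw [← Filter.eventually_false_iff_eq_bot, eventually_nhdsWithin_iff]
            filter_upwards [h7] with w hw hne using hne hw)
    filter_upwards [h1] with y hy
    refine ⟨fun h3 => ?_, fun h3 => absurd h3 h2⟩
    by_cases hyx : y = x
    · rwa [hyx] at h3
    · exact absurd h3.self_of_nhds (hy hyx)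

end ParametricPrimitive

/-! ### The series inside the unit disc -/

/-- The series `∑ z ^ (k + 1) / (k + c) ^ m`. -/
noncomputable def lerchSeries (m : ℕ) (z c : ℂ) : ℂ := ∑' k : ℕ, z ^ (k + 1) / ((k : ℂ) + c) ^ m

/-- The complement of the set of nonpositive integers. -/
def nonpolarSet : Set ℂ := {c | ∀ n : ℕ, c ≠ -(n : ℂ)}

theorem isOpen_nonpolarSet : IsOpen nonpolarSet := by
  have h1 : IsClosed (Set.range fun n : ℕ => -(n : ℂ)) := by
    refine Metric.isClosed_of_pairwise_le_dist (ε := 1) one_pos ?_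
    rintro _ ⟨a, rfl⟩ _ ⟨b, rfl⟩ hab
    have hab' : (a : ℤ) - b ≠ 0 := fun h => hab (by rw [Nat.cast_inj.1 (sub_eq_zero.1 h)])
    have h2 : (1 : ℝ) ≤ ‖(((a : ℤ) - b : ℤ) : ℂ)‖ := by
      rw [Complex.norm_intCast]
      exact_mod_cast Int.one_le_abs hab'
    rw [dist_eq_norm, ← neg_sub', norm_neg]
    simpa using h2
  convert h1.isOpen_compl using 1
  ext c
  simp [nonpolarSet, eq_comm]

theorem add_natCast_mem_nonpolarSet {c : ℂ} (hc : c ∈ nonpolarSet) (N : ℕ) :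
    c + N ∈ nonpolarSet := fun n h => hc (n + N) (by push_cast; linear_combination h)

theorem natCast_add_ne_zero {c : ℂ} (hc : c ∈ nonpolarSet) (k : ℕ) : (k : ℂ) + c ≠ 0 :=
  fun h => hc k (by linear_combination h)

/-- The bound is uniform in `k` and in `c` near `c₀`; it supplies the geometric majorants for the
series. -/
theorem exists_le_norm_add {c₀ : ℂ} (hc₀ : c₀ ∈ nonpolarSet) :
    ∃ δ > 0, ∀ c ∈ Metric.ball c₀ δ, ∀ k : ℕ, δ ≤ ‖(k : ℂ) + c‖ := by
  obtain ⟨r, hr, hball⟩ := Metric.isOpen_iff.1 isOpen_nonpolarSet c₀ hc₀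
  refine ⟨r / 2, by positivity, fun c hc k => ?_⟩
  by_contra! h
  have h1 : -(k : ℂ) ∈ Metric.ball c₀ r := by
    have h2 : dist (-(k : ℂ)) c < r / 2 := by
      rwa [dist_eq_norm, ← norm_neg, neg_sub, sub_neg_eq_add, add_comm]
    rw [Metric.mem_ball] at hc ⊢
    linarith [dist_triangle (-(k : ℂ)) c c₀]
  exact hball h1 k rfl

theorem norm_lerchSeries_term_le {m k : ℕ} {z c : ℂ} {δ r : ℝ} (hδ : 0 < δ)
    (hz : ‖z‖ ≤ r) (hc : δ ≤ ‖(k : ℂ) + c‖) :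
    ‖z ^ (k + 1) / ((k : ℂ) + c) ^ m‖ ≤ r ^ (k + 1) / δ ^ m := by
  rw [norm_div, norm_pow, norm_pow]
  have hr : 0 ≤ r := (norm_nonneg z).trans hz
  gcongr

theorem summable_geometric_div {r : ℝ} (hr0 : 0 ≤ r) (hr : r < 1) (a : ℝ) :
    Summable fun k : ℕ => r ^ (k + 1) / a :=
  ((summable_nat_add_iff 1).2 (summable_geometric_of_lt_one hr0 hr)).div_const a

theorem summable_lerchSeries (m : ℕ) {z c : ℂ} (hz : ‖z‖ < 1) (hc : c ∈ nonpolarSet) :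
    Summable fun k : ℕ => z ^ (k + 1) / ((k : ℂ) + c) ^ m := by
  obtain ⟨δ, hδ, h⟩ := exists_le_norm_add hc
  exact .of_norm_bounded (summable_geometric_div (norm_nonneg z) hz (δ ^ m)) fun k =>
    norm_lerchSeries_term_le hδ le_rfl (h c (Metric.mem_ball_self hδ) k)

theorem hasSum_lerchSeries (m : ℕ) {z c : ℂ} (hz : ‖z‖ < 1) (hc : c ∈ nonpolarSet) :
    HasSum (fun k : ℕ => z ^ (k + 1) / ((k : ℂ) + c) ^ m) (lerchSeries m z c) :=
  (summable_lerchSeries m hz hc).hasSum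

theorem lerchSeries_zero {z : ℂ} (hz : ‖z‖ < 1) (c : ℂ) : lerchSeries 0 z c = z / (1 - z) := by
  simp only [lerchSeries, pow_zero, div_one, pow_succ', tsum_mul_left,
    tsum_geometric_of_norm_lt_one hz]
  rw [div_eq_mul_inv]

theorem analyticAt_lerchSeries (m : ℕ) {z c : ℂ} (hz : ‖z‖ < 1) (hc : c ∈ nonpolarSet) :
    AnalyticAt ℂ (lerchSeries m z) c := by
  obtain ⟨δ, hδ, h⟩ := exists_le_norm_add hc
  refine DifferentiableOn.analyticAt (s := Metric.ball c δ) ?_ (Metric.ball_mem_nhds c hδ)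
  refine Complex.differentiableOn_tsum_of_summable_norm
    (summable_geometric_div (norm_nonneg z) hz (δ ^ m)) (fun k d hd => ?_) Metric.isOpen_ball
    (fun k d hd => norm_lerchSeries_term_le hδ le_rfl (h d hd k))
  have h0 : (k : ℂ) + d ≠ 0 := norm_pos_iff.1 (hδ.trans_le (h d hd k))
  refine DifferentiableAt.differentiableWithinAt ?_
  exact (differentiableAt_const _).div ((differentiableAt_id.const_add _).pow m) (pow_ne_zero m h0)

/-- Differentiate termwise and write `k + 1 = (k + c) - (c - 1)`. -/
theorem hasDerivAt_lerchSeries (m : ℕ) {z c : ℂ} (hz0 : z ≠ 0) (hz : ‖z‖ < 1)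
    (hc : c ∈ nonpolarSet) :
    HasDerivAt (fun z => lerchSeries (m + 1) z c)
      ((lerchSeries m z c - (c - 1) * lerchSeries (m + 1) z c) / z) z := by
  obtain ⟨δ, hδ, h⟩ := exists_le_norm_add hc
  obtain ⟨r, hzr, hr⟩ := exists_between hz
  have hr0 : 0 ≤ r := (norm_nonneg z).trans hzr.le
  have hsum : Summable fun k : ℕ => ((k : ℝ) + 1) * r ^ k / δ ^ (m + 1) := by
    refine Summable.div_const ?_ _
    simp only [add_mul, one_mul]
    refine Summable.add ?_ (summable_geometric_of_lt_one hr0 hr)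
    simpa using summable_pow_mul_geometric_of_norm_lt_one (R := ℝ) 1
      (r := r) (by rwa [Real.norm_of_nonneg hr0])
  have hd := hasDerivAt_tsum_of_isPreconnected hsum Metric.isOpen_ball
    (convex_ball (0 : ℂ) r).isPreconnected
    (g := fun (k : ℕ) z => z ^ (k + 1) / ((k : ℂ) + c) ^ (m + 1))
    (g' := fun (k : ℕ) z => ((k : ℂ) + 1) * z ^ k / ((k : ℂ) + c) ^ (m + 1))
    (fun k w _ => by simpa using (hasDerivAt_pow (k + 1) w).div_const _)
    (fun k w hw => by
      rw [norm_div, norm_mul, norm_pow, norm_pow]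
      have h1 : ‖(k : ℂ) + 1‖ = (k : ℝ) + 1 := by exact_mod_cast Complex.norm_natCast (k + 1)
      have h2 : ‖w‖ ≤ r := (mem_ball_zero_iff.1 hw).le
      have h3 := h c (Metric.mem_ball_self hδ) k
      rw [h1]
      gcongr)
    (mem_ball_zero_iff.2 hzr) (summable_lerchSeries (m + 1) hz hc) (mem_ball_zero_iff.2 hzr)
  refine hd.congr_deriv ?_
  have h1 := ((hasSum_lerchSeries m hz hc).sub
    ((hasSum_lerchSeries (m + 1) hz hc).mul_left (c - 1))).div_const z
  rw [← h1.tsum_eq]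
  refine tsum_congr fun k => ?_
  have := natCast_add_ne_zero hc k
  field_simp
  ring

theorem lerchSeries_eq_sum_add (m N : ℕ) {z c : ℂ} (hz : ‖z‖ < 1) (hc : c ∈ nonpolarSet) :
    lerchSeries m z c = ∑ k ∈ Finset.range N, z ^ (k + 1) / ((k : ℂ) + c) ^ m +
      z ^ N * lerchSeries m z (c + N) := by
  rw [lerchSeries, ← (summable_lerchSeries m hz hc).sum_add_tsum_nat_add N, lerchSeries,
    ← tsum_mul_left]
  congr 1
  refine tsum_congr fun k => ?_
  push_cast
  rw [show (k : ℂ) + N + c = k + (c + N) by ring]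
  rw [show k + N + 1 = N + (k + 1) by omega, pow_add, mul_div_assoc]

theorem eventually_mem_nonpolarSet (n : ℕ) : ∀ᶠ c in 𝓝 (-(n : ℂ)), c ≠ -(n : ℂ) →
    c ∈ nonpolarSet := by
  filter_upwards [Metric.ball_mem_nhds (-(n : ℂ)) one_pos] with c hc hne k hk
  subst hk
  have h1 : ‖(((n : ℤ) - k : ℤ) : ℂ)‖ < 1 := by
    have h0 : -(k : ℂ) - -(n : ℂ) = (((n : ℤ) - k : ℤ) : ℂ) := by
      push_cast
      ring
    rwa [Metric.mem_ball, dist_eq_norm, h0] at hc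
  rw [Complex.norm_intCast] at h1
  have h2 : |(n : ℤ) - k| < 1 := by exact_mod_cast h1
  have h3 : (n : ℤ) = k := sub_eq_zero.1 (Int.abs_lt_one_iff.1 h2)
  exact hne (by rw [Nat.cast_inj.1 h3])

/-! ### Continuation to the cover, shift relation and polar part -/

section Continuation

variable {X : Type*} [TopologicalSpace X] {q : X → ℂ}

theorem IsLocalHomeomorph.locallyPathConnectedSpace (hq : IsLocalHomeomorph q) :
    LocallyPathConnectedSpace X := by
  choose e hxe _ using hq
  let _ : ChartedSpace ℂ X :=
    { atlas := Set.range e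
      chartAt := e
      mem_chart_source := hxe
      chart_mem_atlas := Set.mem_range_self }
  exact ChartedSpace.locallyPathConnectedSpace ℂ X

theorem AnalyticAlong₂.comp_add_const {F : X → ℂ → ℂ} {x : X} {c a : ℂ}
    (h : AnalyticAlong₂ q F x (c + a)) : AnalyticAlong₂ q (fun y d => F y (d + a)) x c := by
  obtain ⟨G, hG, h⟩ := h
  refine ⟨fun w => G (w.1, w.2 + a), ?_, ?_⟩
  · exact AnalyticAt.comp₂ (f := fun w : ℂ × ℂ => w.1) (x := (q x, c)) hG analyticAt_fst
      (analyticAt_snd.add analyticAt_const)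
  · have : Tendsto (fun r : X × ℂ => (r.1, r.2 + a)) (𝓝 (x, c)) (𝓝 (x, c + a)) :=
      (continuous_fst.prodMk (continuous_snd.add continuous_const)).tendsto (x, c)
    exact this.eventually h

theorem AnalyticAlong₂.sum {ι : Type*} {F : ι → X → ℂ → ℂ} {x : X} {c : ℂ} (S : Finset ι)
    (h : ∀ i ∈ S, AnalyticAlong₂ q (F i) x c) :
    AnalyticAlong₂ q (fun y d => ∑ i ∈ S, F i y d) x c := by
  classical
  induction S using Finset.induction_on with
  | empty => simpa using AnalyticAt.analyticAlong₂ (q := q) (G := fun _ => 0) analyticAt_const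
  | insert a S ha ih =>
    simp only [Finset.sum_insert ha]
    exact (h a (Finset.mem_insert_self a S)).add
      (ih fun i hi => h i (Finset.mem_insert_of_mem hi))

theorem analyticAlong₂_term (m k : ℕ) (x : X) {c : ℂ} (hc : (k : ℂ) + c ≠ 0) :
    AnalyticAlong₂ q (fun y d => q y ^ (k + 1) / ((k : ℂ) + d) ^ m) x c :=
  AnalyticAt.analyticAlong₂ (G := fun w => w.1 ^ (k + 1) / ((k : ℂ) + w.2) ^ m)
    ((analyticAt_fst.pow _).div ((analyticAt_const.add analyticAt_snd).pow m) (pow_ne_zero m hc))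

/-- Analytic continuation of the series away from the polar locus. -/
theorem IsLocalHomeomorph.exists_lerchSeries_continuation [SimplyConnectedSpace X]
    [LocallyPathConnectedSpace X] (hq : IsLocalHomeomorph q) (hq0 : ∀ x, q x ≠ 0)
    (hq1 : ∀ x, q x ≠ 1) {Ω : Set X} (hΩ : IsPreconnected Ω) (hΩo : IsOpen Ω) {x₀ : X}
    (hx₀ : x₀ ∈ Ω) (hΩq : ∀ x ∈ Ω, ‖q x‖ < 1) (m : ℕ) :
    ∃ F : X → ℂ → ℂ, (∀ x, ∀ c ∈ nonpolarSet, AnalyticAlong₂ q F x c) ∧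
      ∀ x ∈ Ω, ∀ c ∈ nonpolarSet, F x c = lerchSeries m (q x) c := by
  induction m with
  | zero =>
    refine ⟨fun x _ => q x / (1 - q x), fun x c _ => ?_, fun x hx c _ => ?_⟩
    · exact AnalyticAt.analyticAlong₂ (G := fun w => w.1 / (1 - w.1))
        (analyticAt_fst.div (analyticAt_const.sub analyticAt_fst) (sub_ne_zero.2 (hq1 x).symm))
    · exact (lerchSeries_zero (hΩq x hx) c).symm
  | succ m ih =>
    obtain ⟨F, hF, hFs⟩ := ih
    refine hq.exists_solution hq0 isOpen_nonpolarSet hΩ hΩo hx₀ hF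
      (fun c hc => analyticAt_lerchSeries (m + 1) (hΩq x₀ hx₀) hc) fun x hx c hc => ?_
    rw [hFs x hx c hc]
    exact hasDerivAt_lerchSeries m (hq0 x) (hΩq x hx) hc

/-- The shift relation of the series persists under analytic continuation. -/
theorem IsLocalHomeomorph.lerchSeries_continuation_shift [PreconnectedSpace X]
    (hq : IsLocalHomeomorph q) {Ω : Set X} (hΩo : IsOpen Ω) {x₀ : X}
    (hx₀ : x₀ ∈ Ω) (hΩq : ∀ x ∈ Ω, ‖q x‖ < 1) {m : ℕ} {F : X → ℂ → ℂ}
    (hF : ∀ x, ∀ c ∈ nonpolarSet, AnalyticAlong₂ q F x c)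
    (hFs : ∀ x ∈ Ω, ∀ c ∈ nonpolarSet, F x c = lerchSeries m (q x) c) (N : ℕ) (x : X) {c : ℂ}
    (hc : c ∈ nonpolarSet) :
    F x c = ∑ k ∈ Finset.range N, q x ^ (k + 1) / ((k : ℂ) + c) ^ m + q x ^ N * F x (c + N) := by
  have hcN := add_natCast_mem_nonpolarSet hc N
  have key := hq.eq_zero_of_eventually_eq_zero (x₀ := x₀)
    (f := fun y => F y c + -1 * (∑ k ∈ Finset.range N, q y ^ (k + 1) / ((k : ℂ) + c) ^ m +
      q y ^ N * F y (c + N))) (fun y => ?_) ?_ x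
  · linear_combination key
  · refine AnalyticAlong₂.analyticAlong (F := fun y c => F y c + -1 *
      (∑ k ∈ Finset.range N, q y ^ (k + 1) / ((k : ℂ) + c) ^ m + q y ^ N * F y (c + N)))
      ((hF y c hc).add (AnalyticAlong₂.mul
        (AnalyticAt.analyticAlong₂ (G := fun _ => -1) analyticAt_const)
        ((AnalyticAlong₂.sum _ fun k _ => analyticAlong₂_term m k y (natCast_add_ne_zero hc k)).add
          (AnalyticAlong₂.mul (AnalyticAt.analyticAlong₂ (G := fun w => w.1 ^ N)
            (analyticAt_fst.pow N)) (hF y _ hcN).comp_add_const))))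
  · filter_upwards [hΩo.mem_nhds hx₀] with y hy
    rw [hFs y hy c hc, hFs y hy _ hcN, lerchSeries_eq_sum_add m N (hΩq y hy) hc]
    ring

/-- The structure of the continuation near its polar locus. -/
theorem IsLocalHomeomorph.lerchSeries_continuation_polar [PreconnectedSpace X]
    (hq : IsLocalHomeomorph q) {Ω : Set X} (hΩo : IsOpen Ω) {x₀ : X}
    (hx₀ : x₀ ∈ Ω) (hΩq : ∀ x ∈ Ω, ‖q x‖ < 1) {m : ℕ} (hm : m ≠ 0) {F : X → ℂ → ℂ}
    (hF : ∀ x, ∀ c ∈ nonpolarSet, AnalyticAlong₂ q F x c)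
    (hFs : ∀ x ∈ Ω, ∀ c ∈ nonpolarSet, F x c = lerchSeries m (q x) c) (n : ℕ) :
    ∃ g : X → ℂ → ℂ, (∀ x, AnalyticAlong₂ q g x (-(n : ℂ))) ∧
      (∀ x, g x (-(n : ℂ)) = q x ^ (n + 1)) ∧
      ∀ x, ∀ c ∈ nonpolarSet, F x c = g x c / (c + n) ^ m := by
  -- The shift relation for `N = n + 1` multiplied by `(d + n) ^ m`, with the `k = n` term, the only
  -- singular one, taken out of the sum. The rest vanishes at `d = -n` because `m ≠ 0`.
  refine ⟨fun y d => (d + n) ^ m * (∑ k ∈ Finset.range n, q y ^ (k + 1) / ((k : ℂ) + d) ^ m +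
    q y ^ (n + 1) * F y (d + (n + 1 : ℕ))) + q y ^ (n + 1), fun x => ?_, fun x => ?_,
    fun x c hc => ?_⟩
  · refine AnalyticAlong₂.add (AnalyticAlong₂.mul ?_ (AnalyticAlong₂.add ?_ (AnalyticAlong₂.mul ?_
      (AnalyticAlong₂.comp_add_const (hF x _ ?_))))) ?_
    · exact AnalyticAt.analyticAlong₂ (G := fun w => (w.2 + n) ^ m)
        ((analyticAt_snd.add analyticAt_const).pow m)
    · refine AnalyticAlong₂.sum _ fun k hk => analyticAlong₂_term m k x ?_
      have hkn : k ≠ n := (Finset.mem_range.1 hk).ne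
      rw [← sub_eq_add_neg, sub_ne_zero]
      exact_mod_cast hkn
    · exact AnalyticAt.analyticAlong₂ (G := fun w => w.1 ^ (n + 1)) (analyticAt_fst.pow _)
    -- At `d = -n` the shifted argument equals `1`, which is not polar.
    · intro j hj
      push_cast at hj
      have : ((j + 1 : ℕ) : ℂ) = 0 := by push_cast; linear_combination hj
      exact absurd this (Nat.cast_ne_zero.2 (Nat.succ_ne_zero j))
    · exact AnalyticAt.analyticAlong₂ (G := fun w => w.1 ^ (n + 1)) (analyticAt_fst.pow _)
  · simp [hm]
  · have h0 : c + n ≠ 0 := by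
      rw [add_comm]
      exact natCast_add_ne_zero hc n
    rw [hq.lerchSeries_continuation_shift hΩo hx₀ hΩq hF hFs (n + 1) x hc, Finset.sum_range_succ,
      add_comm (n : ℂ) c, add_div, mul_div_cancel_left₀ _ (pow_ne_zero m h0)]
    ring

end Continuation

/-! ### The main theorem -/

/-- `p : X → ℂ ∖ {0, 1}` is the universal cover, i.e. a covering map with `X` simply connected.
The point `x₀` singles out a sheet over the punctured unit disc (a connected component of its
preimage in `X`), on which the continuation `F` is the given series. -/
theorem theorem2p7 (m : ℕ) (hm : 1 ≤ m)
    {X : Type*} [TopologicalSpace X] [SimplyConnectedSpace X]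
    (p : X → ThricePuncturedSphere) (hp : IsCoveringMap p)
    (x₀ : X) (hx₀ : ‖(p x₀ : ℂ)‖ < 1) :
    ∃ F : X → ℂ → ℂ,
      -- `F` continues `Li_m (z, c) = ∑ z ^ (k + 1) / (k + c) ^ m`
      (∀ x ∈ connectedComponentIn {y : X | ‖(p y : ℂ)‖ < 1} x₀,
        ∀ c : ℂ, (∀ n : ℕ, c ≠ -(n : ℂ)) →
          HasSum (fun k : ℕ => (p x : ℂ) ^ (k + 1) / ((k : ℂ) + c) ^ m) (F x c)) ∧
      -- `F` is meromorphic in two variables, and holomorphic outside `c = 0, -1, -2, …`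
      (∀ (x : X) (c : ℂ), IsMeromorphicAt p F x c) ∧
      (∀ (x : X) (c : ℂ), (∀ n : ℕ, c ≠ -(n : ℂ)) → IsHolomorphicAt p F x c) ∧
      -- for each fixed point of the universal cover, the behaviour in `c`
      (∀ x : X,
        (∀ c : ℂ, MeromorphicAt (F x) c) ∧
        (∀ c : ℂ, (∀ n : ℕ, c ≠ -(n : ℂ)) → AnalyticAt ℂ (F x) c) ∧
        (∀ n : ℕ, meromorphicOrderAt (F x) (-(n : ℂ)) = ((-(m : ℤ) : ℤ) : WithTop ℤ))) := by
  let q : X → ℂ := fun x => p x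
  have hq : IsLocalHomeomorph q := by
    have hopen : IsOpen {z : ℂ | z ≠ 0 ∧ z ≠ 1} := isOpen_ne.and isOpen_ne
    exact hopen.isOpenEmbedding_subtypeVal.isLocalHomeomorph.comp hp.isLocalHomeomorph
  have := hq.locallyPathConnectedSpace
  have hso : IsOpen {y : X | ‖q y‖ < 1} := isOpen_lt hq.continuous.norm continuous_const
  have hΩo : IsOpen (connectedComponentIn {y : X | ‖q y‖ < 1} x₀) := hso.connectedComponentIn
  have hx₀Ω : x₀ ∈ connectedComponentIn {y : X | ‖q y‖ < 1} x₀ := mem_connectedComponentIn hx₀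
  have hΩq : ∀ x ∈ connectedComponentIn {y : X | ‖q y‖ < 1} x₀, ‖q x‖ < 1 := fun x hx =>
    (connectedComponentIn_subset {y : X | ‖q y‖ < 1} x₀ hx :)
  obtain ⟨F, hF, hFs⟩ := hq.exists_lerchSeries_continuation (fun x => (p x).2.1)
    (fun x => (p x).2.2) isPreconnected_connectedComponentIn hΩo hx₀Ω hΩq m
  have hm0 : m ≠ 0 := Nat.one_le_iff_ne_zero.1 hm
  choose g hg hgn hFg using hq.lerchSeries_continuation_polar hΩo hx₀Ω hΩq hm0 hF hFs
  have horder : ∀ (x : X) (n : ℕ), MeromorphicAt (F x) (-(n : ℂ)) ∧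
      meromorphicOrderAt (F x) (-(n : ℂ)) = ((-(m : ℤ) : ℤ) : WithTop ℤ) := by
    intro x n
    have hev : ∀ᶠ c in 𝓝[≠] (-(n : ℂ)), F x c = (c - -(n : ℂ)) ^ (-(m : ℤ)) • g n x c := by
      rw [eventually_nhdsWithin_iff]
      filter_upwards [eventually_mem_nonpolarSet n] with c hc hne
      rw [hFg n x c (hc hne), sub_neg_eq_add, zpow_neg, zpow_natCast, smul_eq_mul, mul_comm,
        div_eq_mul_inv]
    have hga := (hg n x).analyticAt
    have hmer : MeromorphicAt (F x) (-(n : ℂ)) := by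
      refine MeromorphicAt.congr ?_ (EventuallyEq.symm hev)
      exact (((MeromorphicAt.id _).sub (MeromorphicAt.const _ _)).zpow _).smul hga.meromorphicAt
    refine ⟨hmer, (meromorphicOrderAt_eq_int_iff hmer).2 ⟨g n x, hga, ?_, hev⟩⟩
    rw [hgn]
    exact pow_ne_zero _ (p x).2.1
  refine ⟨F, fun x hx c hc => ?_, fun x c => ?_, hF, fun x =>
    ⟨fun c => ?_, fun c hc => (hF x c hc).analyticAt, fun n => (horder x n).2⟩⟩
  · rw [hFs x hx c hc]
    exact hasSum_lerchSeries m (hΩq x hx) hc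
  · by_cases hc : c ∈ nonpolarSet
    · obtain ⟨G, hG, hFG⟩ := hF x c hc
      exact ⟨G, fun _ => 1, hG, analyticAt_const, (Eventually.of_forall fun _ => one_ne_zero).frequently,
        hFG.mono fun r hr _ => by rw [hr, div_one]⟩
    · obtain ⟨n, rfl⟩ : ∃ n : ℕ, c = -(n : ℂ) := by simpa [nonpolarSet] using hc
      obtain ⟨G, hG, hgG⟩ := hg n x
      refine ⟨G, fun w => (w.2 + n) ^ m, hG, (analyticAt_snd.add analyticAt_const).pow m, ?_, ?_⟩
      -- The denominator is nonzero along the punctured slice with first coordinate `p x`, which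
      -- accumulates at the point.
      · have h1 : Tendsto (fun d : ℂ => ((p x : ℂ), d)) (𝓝[≠] (-(n : ℂ))) (𝓝 ((p x : ℂ), -(n : ℂ))) :=
          ((Continuous.prodMk_right _).tendsto _).mono_left nhdsWithin_le_nhds
        refine h1.frequently (Eventually.frequently ?_)
        filter_upwards [self_mem_nhdsWithin] with d hd
        exact pow_ne_zero m fun h => hd (eq_neg_of_add_eq_zero_left h)
      · filter_upwards [hgG, (continuous_snd.tendsto (x, -(n : ℂ))).eventually
          (eventually_mem_nonpolarSet n)] with r hr hmem hne
        rw [← hr]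
        refine hFg n r.1 r.2 (hmem fun h => hne ?_)
        rw [h, neg_add_cancel, zero_pow hm0]
  · by_cases hc : c ∈ nonpolarSet
    · exact (hF x c hc).analyticAt.meromorphicAt
    · obtain ⟨n, rfl⟩ : ∃ n : ℕ, c = -(n : ℂ) := by simpa [nonpolarSet] using hc
      exact (horder x n).1
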